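/- **Setting.** Let $d\ge 1$, let $\mathcal X\subset\mathbb R^d$ be a compact convex set with non-empty interior, and let $\operatorname{rad}(\mathcal X)=\max\{r>0:\exists x\in\mathcal X,\ B(x,r)\subseteq\mathcal X\}$, where $B(x,r)$ is the closed Euclidean ball. The ranking rule induced by a function $h:\mathcal X\to\mathbb R$ is $r_h(x,x')=\operatorname{sgn}(h(x)-h(x'))\in\{-1,0,1\}$. A continuous ranking structure is any set $\mathcal R$ of ranking rules $r_h$ with $h:\mathcal X\to\mathbb R$ continuous. **Algorithm.** RankOpt$(n,f,\mathcal X,\mathcal R)$ draws candidates independently and uniformly from $\mathcal X$. The first candidate is the first evaluation point $X_1$. After the evaluation of $f$ at $X_1,\dots,X_t$ $(1\le t<n)$, choose $\hat\imath_t\in\arg\max_{1\le i\le t}f(X_i)$ and let $\mathcal R_t$ be the set of the $r\in\mathcal R$ whose empirical ranking loss $L_t(r)=\frac{2}{t(t-1)}\sum_{1\le i<j\le t}\mathbf 1\{r(X_i,X_j)\ne r_f(X_i,X_j)\}$ vanishes (with $\mathcal R_1=\mathcal R$). Candidates are then drawn and discarded until one, $x$, is such that $r(x,X_{\hat\imath_t})\ge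 0$ for some $r\in\mathcal R_t$, and this candidate is $X_{t+1}$. The output is $X_{\hat\imath_n}$ with $\hat\imath_n\in\arg\max_{1\le i\le n}f(X_i)$. **Theorem (Lower bound).** Let $\mathcal R$ be a continuous ranking structure over $\mathcal X$ and let $f:\mathcal X\to\mathbb R$ be such that $r_f\in\mathcal R$. Suppose that $f$ has $(c_\alpha,\alpha)$-regular level sets for some $c_\alpha>0$ and $\alpha\ge 0$: the global maximizer $x^\star$ of $f$ is unique, and for every $y$ in the image of $f$, $$\max_{x\in f^{-1}(y)}\|x^\star-x\|_2\le c_\alpha\cdot\min_{x\in f^{-1}(y)}\|x^\star-x\|_2^{1/(1+\alpha)}.$$ Then, for all integers $n\ge 1$ and all $\delta\in(0,1)$, with probability at least $1-\delta$, RankOpt$(n,f,\mathcal X,\mathcal R)$ completes its $n$ evaluations and, however ties in the choice of the $\hat\imath_t$ are broken, its output satisfies $$C_2\, \exp\!\left(-\frac{(1+\alpha)^2}{d}\Bigl(n+\sqrt{2n\ln(1/\delta)}+\ln(1/\delta)\Bigr)\right)\le\|x^\star-X_{\hat\imath_n}\|_2, \qquad C_2=c_\alpha^{-(1+\alpha)(2+\alpha)}\operatorname{rad}(\mathcal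 X)^{(1+\alpha)^2}.$$ -/

import Mathlib

open MeasureTheory ProbabilityTheory

namespace RankOpt

noncomputable section

/-- The ranking rule `r_f` induced by `f`; the three values `-1, 0, 1` are those of `SignType`. -/
def rankingRule {𝒳 : Type*} (f : 𝒳 → ℝ) : 𝒳 → 𝒳 → SignType :=
  fun x x' => SignType.sign (f x - f x')

/-- The set of continuous ranking rules over `𝒳`. A continuous ranking structure is a subset
of it. -/
def continuousRankingRules (𝒳 : Type*) [TopologicalSpace 𝒳] : Set (𝒳 → 𝒳 → SignType) :=
  {r | ∃ h : 𝒳 → ℝ, Continuous h ∧ r = rankingRule h}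

open Classical in
/-- The empirical ranking loss `L_t(r)` over the evaluated points `x 1, …, x t`.
(For `t = 1` the sum is empty and the value is `0`.) -/
def empiricalLoss {𝒳 : Type*} (f : 𝒳 → ℝ) (x : ℕ → 𝒳) (t : ℕ) (r : 𝒳 → 𝒳 → SignType) : ℝ :=
  2 / ((t : ℝ) * ((t : ℝ) - 1)) *
    ∑ j ∈ Finset.Icc 1 t, ∑ i ∈ Finset.Ico 1 j,
      if r (x i) (x j) ≠ rankingRule f (x i) (x j) then (1 : ℝ) else 0

/-- The active subset `ℛ_t` of the rules in `ℛ` consistent with `r_f` over `x 1, …, x t`.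
For `t = 1` it is `ℛ`. -/
def activeSubset {𝒳 : Type*} (f : 𝒳 → ℝ) (ℛ : Set (𝒳 → 𝒳 → SignType)) (x : ℕ → 𝒳) (t : ℕ) :
    Set (𝒳 → 𝒳 → SignType) :=
  {r ∈ ℛ | empiricalLoss f x t r = 0}

/-- The decision rule: after the evaluations at `x 1, …, x t`, of which `x i` is a best one, the
candidate `z` is accepted for evaluation. -/
def Accepts {𝒳 : Type*} (f : 𝒳 → ℝ) (ℛ : Set (𝒳 → 𝒳 → SignType)) (x : ℕ → 𝒳) (t i : ℕ)
    (z : 𝒳) : Prop :=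
  ∃ r ∈ activeSubset f ℛ x t, 0 ≤ r z (x i)

/-- A complete run of RankOpt with `n` evaluations on the stream `u 0, u 1, …` of candidates.
`time t` is the position in the stream of the candidate that is evaluated at step `t`, so that the
`t`-th evaluation point is `u (time t)` (`1 ≤ t ≤ n`), and `best t` is the index chosen among the
maximizers of `f` over the first `t` evaluation points (ties are broken arbitrarily).
After step `t`, candidates are drawn and discarded until one is accepted by the decision rule. -/
structure IsRun {𝒳 : Type*} (f : 𝒳 → ℝ) (ℛ : Set (𝒳 → 𝒳 → SignType)) (n : ℕ) (u : ℕ → 𝒳)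
    (time best : ℕ → ℕ) : Prop where
  time_one : time 1 = 0
  best_mem : ∀ t, 1 ≤ t → t ≤ n → best t ∈ Finset.Icc 1 t
  best_max : ∀ t, 1 ≤ t → t ≤ n → ∀ i ∈ Finset.Icc 1 t, f (u (time i)) ≤ f (u (time (best t)))
  time_succ : ∀ t, 1 ≤ t → t < n →
    IsLeast {k | time t < k ∧ Accepts f ℛ (fun i => u (time i)) t (best t) (u k)} (time (t + 1))

/-- `z` is an output of RankOpt with `n` evaluations on the stream `u` of candidates:
the algorithm completes its `n` evaluations and returns `z`, for some way of breaking ties. -/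
def IsOutput {𝒳 : Type*} (f : 𝒳 → ℝ) (ℛ : Set (𝒳 → 𝒳 → SignType)) (n : ℕ) (u : ℕ → 𝒳)
    (z : 𝒳) : Prop :=
  ∃ time best : ℕ → ℕ, IsRun f ℛ n u time best ∧ z = u (time (best n))

/-- `f : X → ℝ` has `(c, α)`-regular level sets, and `xs` is its unique global maximizer. -/
structure HasRegularLevelSets {d : ℕ} {X : Set (EuclideanSpace ℝ (Fin d))} (f : X → ℝ)
    (c α : ℝ) (xs : X) : Prop where
  c_pos : 0 < c
  α_nonneg : 0 ≤ α
  isMax : ∀ x, f x ≤ f xs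
  unique : ∀ z, (∀ x, f x ≤ f z) → z = xs
  regular : ∀ y ∈ Set.range f,
    sSup ((fun x : X => ‖(xs : EuclideanSpace ℝ (Fin d)) - x‖) '' (f ⁻¹' {y})) ≤
      c * sInf ((fun x : X => ‖(xs : EuclideanSpace ℝ (Fin d)) - x‖ ^ (1 / (1 + α))) ''
        (f ⁻¹' {y}))

/-- The inner radius of `X`: the largest radius of a closed ball contained in `X`. -/
def innerRadius {d : ℕ} (X : Set (EuclideanSpace ℝ (Fin d))) : ℝ :=
  sSup {r : ℝ | 0 < r ∧ ∃ x ∈ X, Metric.closedBall x r ⊆ X}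

end

end RankOpt

/-!
Every candidate `z` of the stream with `f z ≥ f (best)` is accepted, because `r_f` itself is active
at every step. Hence, whatever else is accepted, the best evaluated value is the maximum of `f` over
the part of the stream seen so far, and after `n` evaluations the stream has produced at most `n`
weak records (`IsRun.recordState_time`). The output therefore has a value that is at most the value
of the `n`-th weak record. The acceptance sets, which need not be measurable, play no other role.

Since `r_f = r_h` for a continuous `h`, the values `h (U k)` form an iid sequence of real random
variables, of law `ν` say. Put `v a = ν [a, ∞)`. The random variable `v (Y)`, `Y ∼ ν`, is
stochastically larger than a uniform one (`measure_tail_le_le`), so that for `0 < l < 1` each weak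
record multiplies the mean of `v ^ (-l)` by at most `1 / (1 - l)`. Thus `(1 - l) ^ j * v ^ (-l)`,
with `j` the number of weak records and `v` taken at the last one, is a supermartingale along the
stream (`lintegral_recordPotential_step_le`). Markov's inequality with `l = 1 - n / s`, where
`s = n + √(2 n log (1/δ)) + log (1/δ)`, shows that `v ≥ exp (-s)` at the `n`-th record with
probability at least `1 - δ` (`measure_recordState_tail_lt_le`, `exp_neg_div_one_sub_pow_le`).
Almost surely every value is later matched or exceeded, so that the runs are completed
(`ae_exists_ge`, `exists_isRun`).

On this event the superlevel set `{f ≥ f z}` of the output `z` has at least the fraction `exp (-s)`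
of the volume of `X`. Along the segment from `xs` to `z` the function `h` takes every value between
`h z` and its maximum, so the regularity of the level sets puts the superlevel set into the ball of
radius `c * ‖xs - z‖ ^ (1 / (1 + α))` about `xs` (`HasRegularLevelSets.norm_sub_le`). Comparing
volumes bounds this radius below by `rad X * exp (-s / d)` (`innerRadius_mul_le`).
-/

namespace RankOpt

open Set Filter
open scoped ENNReal

/-! ### The upper tail of a law on the real line -/

lemma measurable_measure_Ici (ν : Measure ℝ) : Measurable fun x => ν (Ici x) :=
  Antitone.measurable fun _ _ hab => measure_mono (Ici_subset_Ici.2 hab)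

/-- The tail function `x ↦ ν [x, ∞)`, evaluated at a point drawn from `ν`, is stochastically larger
than a uniform random variable on `[0, 1]` if `ν` is a probability measure. -/
lemma measure_tail_le_le (ν : Measure ℝ) [IsFiniteMeasure ν] (u : ℝ≥0∞) :
    ν {x | ν (Ici x) ≤ u} ≤ u := by
  have hS : MeasurableSet {x | ν (Ici x) ≤ u} := measurable_measure_Ici ν measurableSet_Iic
  -- A compact `K` in this set has a least element `a`, so that `K ⊆ [a, ∞)`.
  rw [hS.measure_eq_iSup_isCompact_of_ne_top (measure_ne_top _ _)]
  refine iSup₂_le fun K hK => iSup_le fun hKc => ?_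
  rcases K.eq_empty_or_nonempty with rfl | hne
  · simp
  obtain ⟨a, haK, ha⟩ := hKc.exists_isLeast hne
  exact (measure_mono fun x hx => ha hx).trans (hK haK)

lemma lintegral_Ioi_rpow_neg_inv {l V : ℝ} (hl0 : 0 < l) (hl1 : l < 1) (hV : 0 < V) :
    ∫⁻ t in Ioi (V ^ (-l)), ENNReal.ofReal (t ^ (-l⁻¹)) =
      ENNReal.ofReal (l / (1 - l) * V ^ (1 - l)) := by
  have hc : 0 < V ^ (-l) := Real.rpow_pos_of_pos hV _
  have hlt : -l⁻¹ < -1 := neg_lt_neg ((one_lt_inv₀ hl0).2 hl1)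
  rw [← ofReal_integral_eq_lintegral_ofReal (integrableOn_Ioi_rpow_of_lt hlt hc)
    ((ae_restrict_mem measurableSet_Ioi).mono fun t ht =>
      Real.rpow_nonneg (hc.le.trans (mem_Ioi.1 ht).le) _),
    integral_Ioi_rpow_of_lt hlt hc, ← Real.rpow_mul hV.le]
  congr 1
  have h1 : -l * (-l⁻¹ + 1) = 1 - l := by linear_combination mul_inv_cancel₀ hl0.ne'
  have h2 : -l⁻¹ + 1 ≠ 0 := by linarith
  have h3 : 1 - l ≠ 0 := by linarith
  rw [h1]
  have h4 : -l⁻¹ + 1 = -((1 - l) / l) := by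
    rw [sub_div, div_self hl0.ne', one_div]; ring
  rw [h4]
  field_simp

/-- The integral of `ν [x, ∞) ^ (-l)` over `S` is at most that of `u ^ (-l)` over `0 < u ≤ ν S`, by
the comparison of the tail with a uniform variable. -/
lemma setLIntegral_tail_rpow_neg_le (ν : Measure ℝ) [IsFiniteMeasure ν] {l : ℝ} (hl0 : 0 < l)
    (hl1 : l < 1) (S : Set ℝ) :
    ENNReal.ofReal (1 - l) * ∫⁻ x in S, ν (Ici x) ^ (-l) ∂ν ≤ ν S ^ (1 - l) := by
  rcases eq_or_ne (ν S) 0 with h0 | h0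
  · simp [Measure.restrict_eq_zero.2 h0]
  have hV : 0 < ν.real S := ENNReal.toReal_pos h0 (measure_ne_top _ _)
  have hae : ∀ᵐ x ∂ν.restrict S, 0 < ν (Ici x) := by
    refine ae_restrict_of_ae ?_
    have : ν {x | ν (Ici x) ≤ 0} = 0 := le_antisymm (measure_tail_le_le ν 0) bot_le
    simpa [ae_iff] using this
  have hcongr : ∫⁻ x in S, ν (Ici x) ^ (-l) ∂ν =
      ∫⁻ x in S, ENNReal.ofReal (ν.real (Ici x) ^ (-l)) ∂ν := by
    refine lintegral_congr_ae (hae.mono fun x hx => ?_)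
    simp only
    rw [Measure.real, ← ENNReal.ofReal_rpow_of_pos (ENNReal.toReal_pos hx.ne' (measure_ne_top _ _)),
      ENNReal.ofReal_toReal (measure_ne_top _ _)]
  have hmeas : Measurable fun x => ν.real (Ici x) ^ (-l) :=
    (measurable_measure_Ici ν).ennreal_toReal.pow_const _
  have hc : 0 < ν.real S ^ (-l) := Real.rpow_pos_of_pos hV _
  rw [hcongr, lintegral_eq_lintegral_meas_lt _ (ae_of_all _ fun x => by positivity)
    hmeas.aemeasurable, ← Ioc_union_Ioi_eq_Ioi hc.le,
    lintegral_union measurableSet_Ioi (Ioc_disjoint_Ioi le_rfl)]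
  -- Layer cake: `ν S` bounds the measures of the superlevel sets for `t ≤ (ν S) ^ (-l)`, and
  -- `t ^ (-1 / l)` bounds them above.
  have h1 : ∫⁻ t in Ioc 0 (ν.real S ^ (-l)),
      (ν.restrict S) {a | t < ν.real (Ici a) ^ (-l)} ≤ ENNReal.ofReal (ν.real S ^ (1 - l)) := by
    calc _ ≤ ∫⁻ t in Ioc 0 (ν.real S ^ (-l)), ν S :=
          lintegral_mono fun t => (measure_mono (subset_univ _)).trans (by simp)
      _ = ENNReal.ofReal (ν.real S ^ (1 - l)) := by
          rw [setLIntegral_const, Real.volume_Ioc, sub_zero, Real.rpow_sub hV, Real.rpow_one,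
            Real.rpow_neg hV.le, div_eq_mul_inv, ENNReal.ofReal_mul hV.le, Measure.real,
            ENNReal.ofReal_toReal (measure_ne_top _ _)]
  have h2 : ∫⁻ t in Ioi (ν.real S ^ (-l)), (ν.restrict S) {a | t < ν.real (Ici a) ^ (-l)} ≤
      ENNReal.ofReal (l / (1 - l) * ν.real S ^ (1 - l)) := by
    rw [← lintegral_Ioi_rpow_neg_inv hl0 hl1 hV]
    refine setLIntegral_mono' measurableSet_Ioi fun t ht => ?_
    have ht0 : 0 < t := hc.trans ht
    refine (Measure.restrict_apply_le _ _).trans ?_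
    refine le_trans (measure_mono fun a ha => ?_) (measure_tail_le_le ν _)
    have ha' : t < ν.real (Ici a) ^ (-l) := ha
    rw [mem_ofPred_eq, ← ENNReal.ofReal_toReal (measure_ne_top ν (Ici a))]
    refine ENNReal.ofReal_le_ofReal ?_
    rcases (measureReal_nonneg (μ := ν) (s := Ici a)).eq_or_lt with h | h
    · exact h.symm.le.trans (by positivity)
    have := Real.rpow_le_rpow_of_nonpos ht0 ha'.le (neg_nonpos.2 (inv_pos.2 hl0).le)
    rw [← Real.rpow_mul h.le] at this
    simpa [Measure.real, hl0.ne'] using this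
  calc _ ≤ ENNReal.ofReal (1 - l) * (ENNReal.ofReal (ν.real S ^ (1 - l)) +
        ENNReal.ofReal (l / (1 - l) * ν.real S ^ (1 - l))) := by gcongr
    _ = ENNReal.ofReal (ν.real S ^ (1 - l)) := by
      have h3 : 0 < 1 - l := by linarith
      rw [← ENNReal.ofReal_add (by positivity) (by positivity), ← ENNReal.ofReal_mul h3.le]
      congr 1
      field_simp
      ring
    _ = ν S ^ (1 - l) := by
      rw [← ENNReal.ofReal_rpow_of_pos hV, Measure.real,
        ENNReal.ofReal_toReal (measure_ne_top _ _)]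

/-! ### Weak records of a sequence -/

/-- The update of the pair (number of weak records, value of the last one) by a new value `x`.
Once `n` records have been counted the pair is frozen. -/
noncomputable def recordStep (n : ℕ) (s : ℕ × ℝ) (x : ℝ) : ℕ × ℝ :=
  if s.1 < n ∧ s.2 ≤ x then (s.1 + 1, x) else s

/-- The number of weak records among `y 0, …, y k`, capped at `n`, and the value of the last record
that was counted. The first value `y 0` counts as a record. -/
noncomputable def recordState (n : ℕ) (y : ℕ → ℝ) : ℕ → ℕ × ℝ
  | 0 => (1, y 0)
  | k + 1 => recordStep n (recordState n y k) (y (k + 1))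

/-- The potential `(1 - l) ^ j * ν [y, ∞) ^ (-l)` of the state `(j, y)`, which is `∞` if
`ν [y, ∞) = 0` and `0 < l < 1`. -/
noncomputable def recordPotential (ν : Measure ℝ) (l : ℝ) (s : ℕ × ℝ) : ℝ≥0∞ :=
  ENNReal.ofReal (1 - l) ^ s.1 * ν (Ici s.2) ^ (-l)

lemma measurable_recordStep (n : ℕ) : Measurable fun p : (ℕ × ℝ) × ℝ => recordStep n p.1 p.2 := by
  unfold recordStep
  refine Measurable.ite ?_ (by fun_prop) (by fun_prop)
  exact (measurableSet_lt (f := fun p : (ℕ × ℝ) × ℝ => p.1.1) (by fun_prop)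
    measurable_const).inter (measurableSet_le (f := fun p : (ℕ × ℝ) × ℝ => p.1.2)
      (by fun_prop) measurable_snd)

lemma measurable_recordState (n k : ℕ) : Measurable fun y : ℕ → ℝ => recordState n y k := by
  induction k with
  | zero => exact measurable_const.prodMk (measurable_pi_apply 0)
  | succ k ih => exact (measurable_recordStep n).comp (ih.prodMk (measurable_pi_apply (k + 1)))

lemma recordState_congr {n k : ℕ} {y y' : ℕ → ℝ} (h : ∀ i ≤ k, y i = y' i) :
    recordState n y k = recordState n y' k := by
  induction k with
  | zero => simp [recordState, h 0 le_rfl]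
  | succ k ih => simp [recordState, h (k + 1) le_rfl, ih fun i hi => h i (hi.trans k.le_succ)]

lemma measurable_recordPotential (ν : Measure ℝ) (l : ℝ) : Measurable (recordPotential ν l) := by
  unfold recordPotential
  refine Measurable.mul (by fun_prop) ?_
  exact ((measurable_measure_Ici ν).comp measurable_snd).pow_const _

lemma recordState_fst_le {n : ℕ} (hn : 1 ≤ n) (y : ℕ → ℝ) (k : ℕ) : (recordState n y k).1 ≤ n := by
  induction k with
  | zero => exact hn
  | succ k ih =>
    simp only [recordState, recordStep]
    split_ifs with h
    · exact h.1
    · exact ih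

lemma recordState_snd_mono (n : ℕ) (y : ℕ → ℝ) : Monotone fun k => (recordState n y k).2 := by
  refine monotone_nat_of_le_succ fun k => ?_
  simp only [recordState, recordStep]
  split_ifs with h
  · exact h.2
  · exact le_rfl

/-- The supermartingale inequality for the potential. A new record occurs with probability
`ν [y, ∞)`, and is then distributed as `ν` restricted to `[y, ∞)`. -/
lemma lintegral_recordPotential_step_le (ν : Measure ℝ) [IsProbabilityMeasure ν] {l : ℝ}
    (hl0 : 0 < l) (hl1 : l < 1) (n : ℕ) (s : ℕ × ℝ) :
    ∫⁻ x, recordPotential ν l (recordStep n s x) ∂ν ≤ recordPotential ν l s := by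
  by_cases hs : s.1 < n
  swap
  · simp [recordStep, hs]
  rcases eq_or_ne (ν (Ici s.2)) 0 with h0 | h0
  · have : recordPotential ν l s = ∞ := by
      rw [recordPotential, h0, ENNReal.zero_rpow_of_neg (by linarith), ENNReal.mul_top]
      exact pow_ne_zero _ (by simpa using hl1)
    simp [this]
  rw [← lintegral_add_compl _ (measurableSet_Ici (a := s.2))]
  have h1 : ∫⁻ x in Ici s.2, recordPotential ν l (recordStep n s x) ∂ν =
      ENNReal.ofReal (1 - l) ^ s.1 *
        (ENNReal.ofReal (1 - l) * ∫⁻ x in Ici s.2, ν (Ici x) ^ (-l) ∂ν) := by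
    rw [← mul_assoc, ← pow_succ, ← lintegral_const_mul' _ _ (by finiteness)]
    refine setLIntegral_congr_fun measurableSet_Ici fun x hx => ?_
    have hx' : s.2 ≤ x := hx
    simp [recordStep, hs, hx', recordPotential]
  have h2 : ∫⁻ x in (Ici s.2)ᶜ, recordPotential ν l (recordStep n s x) ∂ν =
      recordPotential ν l s * ν (Ici s.2)ᶜ := by
    rw [← setLIntegral_const]
    refine setLIntegral_congr_fun measurableSet_Ici.compl fun x hx => ?_
    have hx' : ¬ s.2 ≤ x := hx
    simp [recordStep, hx']
  have h3 : ν (Ici s.2) ^ (1 - l) = ν (Ici s.2) ^ (-l) * ν (Ici s.2) := by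
    nth_rw 3 [← ENNReal.rpow_one (ν (Ici s.2))]
    rw [← ENNReal.rpow_add _ _ h0 (measure_ne_top _ _)]
    congr 1; ring
  rw [h1, h2]
  calc _ ≤ ENNReal.ofReal (1 - l) ^ s.1 * ν (Ici s.2) ^ (1 - l) +
        recordPotential ν l s * ν (Ici s.2)ᶜ := by
        gcongr; exact setLIntegral_tail_rpow_neg_le ν hl0 hl1 _
    _ = recordPotential ν l s * (ν (Ici s.2) + ν (Ici s.2)ᶜ) := by
        rw [h3, recordPotential]; ring
    _ = recordPotential ν l s := by rw [prob_add_prob_compl measurableSet_Ici, mul_one]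

/-! ### Weak records of an iid sequence -/

section iid

variable {Ω : Type*} [MeasurableSpace Ω] {P : Measure Ω} {Y : ℕ → Ω → ℝ}
  {ν : Measure ℝ}

lemma indepFun_recordState (hY : ∀ k, Measurable (Y k)) (hind : iIndepFun Y P) (n k : ℕ) :
    IndepFun (fun ω => recordState n (fun i => Y i ω) k) (Y (k + 1)) P := by
  have h := hind.indepFun_finset (Finset.range (k + 1)) {k + 1} (by simp) hY
  -- Extension by zero: the state at time `k` depends on the first `k + 1` values only.
  let e : (Finset.range (k + 1) → ℝ) → ℕ → ℝ := fun p i =>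
    if hi : i ∈ Finset.range (k + 1) then p ⟨i, hi⟩ else 0
  have he : Measurable e := measurable_pi_lambda _ fun i => by
    by_cases hi : i ∈ Finset.range (k + 1)
    · simpa only [e, hi, dite_true] using measurable_pi_apply _
    · simp only [e, hi, dite_false, measurable_const]
  have hlast : Measurable fun q : (({k + 1} : Finset ℕ) → ℝ) => q ⟨k + 1, by simp⟩ :=
    measurable_pi_apply _
  have h' := h.comp (φ := fun p => recordState n (e p) k)
    (ψ := fun q : (({k + 1} : Finset ℕ) → ℝ) => q ⟨k + 1, by simp⟩)
    ((measurable_recordState n k).comp he) hlast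
  refine (h'.congr (ae_of_all _ fun ω => ?_) (ae_of_all _ fun ω => rfl))
  refine recordState_congr fun i hi => ?_
  simp [e, hi.not_gt]

lemma lintegral_recordPotential_le [IsProbabilityMeasure P] [IsProbabilityMeasure ν]
    (hY : ∀ k, Measurable (Y k))
    (hind : iIndepFun Y P) (hlaw : ∀ k, P.map (Y k) = ν) {l : ℝ} (hl0 : 0 < l) (hl1 : l < 1)
    (n k : ℕ) : ∫⁻ ω, recordPotential ν l (recordState n (fun i => Y i ω) k) ∂P ≤ 1 := by
  have hS (k : ℕ) : Measurable fun ω => recordState n (fun i => Y i ω) k :=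
    (measurable_recordState n k).comp (measurable_pi_lambda _ hY)
  have hw := measurable_recordPotential ν l
  induction k with
  | zero =>
    have := setLIntegral_tail_rpow_neg_le ν hl0 hl1 univ
    have hmeas : Measurable fun x => recordPotential ν l (1, x) :=
      hw.comp (measurable_const.prodMk measurable_id)
    simp only [recordState]
    rw [← lintegral_map hmeas (hY 0), hlaw 0]
    simp only [recordPotential, pow_one]
    rw [lintegral_const_mul' _ _ (by finiteness)]
    simpa using this
  | succ k ih =>
    refine le_trans ?_ ih
    have hmeas : Measurable fun p : (ℕ × ℝ) × ℝ => recordPotential ν l (recordStep n p.1 p.2) :=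
      hw.comp (measurable_recordStep n)
    have hpair := (indepFun_iff_map_prod_eq_prod_map_map (hS k).aemeasurable
      (hY (k + 1)).aemeasurable).1 (indepFun_recordState hY hind n k)
    simp only [recordState]
    have := Measure.isProbabilityMeasure_map (μ := P) (hS k).aemeasurable
    rw [← lintegral_map (f := fun p : (ℕ × ℝ) × ℝ => recordPotential ν l (recordStep n p.1 p.2))
      hmeas ((hS k).prodMk (hY (k + 1))), hpair, hlaw (k + 1), lintegral_prod _ hmeas.aemeasurable,
      ← lintegral_map hw (hS k)]
    exact lintegral_mono fun s => lintegral_recordPotential_step_le ν hl0 hl1 n s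

/-- As the last counted record value increases with `k`, the bound for a fixed `k` from Markov's
inequality holds uniformly in `k`. -/
lemma measure_recordState_tail_lt_le [IsProbabilityMeasure P] [IsProbabilityMeasure ν]
    (hY : ∀ k, Measurable (Y k))
    (hind : iIndepFun Y P) (hlaw : ∀ k, P.map (Y k) = ν) {l : ℝ} (hl0 : 0 < l) (hl1 : l < 1)
    {n : ℕ} (hn : 1 ≤ n) (s : ℝ) :
    P {ω | ∃ k, ν (Ici (recordState n (fun i => Y i ω) k).2) < ENNReal.ofReal (Real.exp (-s))} ≤
      ENNReal.ofReal (Real.exp (-(l * s)) / (1 - l) ^ n) := by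
  have hl : 0 < 1 - l := by linarith
  rw [ofPred_exists, Monotone.measure_iUnion]
  · refine iSup_le fun k => ?_
    have hmark := mul_meas_ge_le_lintegral₀ (μ := P)
      (f := fun ω => recordPotential ν l (recordState n (fun i => Y i ω) k))
      ((measurable_recordPotential ν l).comp ((measurable_recordState n k).comp
        (measurable_pi_lambda _ hY))).aemeasurable (ENNReal.ofReal ((1 - l) ^ n * Real.exp (l * s)))
    have hpos : 0 < (1 - l) ^ n * Real.exp (l * s) := by positivity
    have h1 := hmark.trans (lintegral_recordPotential_le hY hind hlaw hl0 hl1 n k)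
    have h2 : ENNReal.ofReal (Real.exp (-(l * s)) / (1 - l) ^ n) =
        (ENNReal.ofReal ((1 - l) ^ n * Real.exp (l * s)))⁻¹ := by
      rw [← ENNReal.ofReal_inv_of_pos hpos, Real.exp_neg, mul_inv, div_eq_mul_inv, mul_comm]
    rw [h2, ← one_div]
    rw [mul_comm, ← ENNReal.le_div_iff_mul_le (Or.inl (by simpa using hpos))
      (Or.inl ENNReal.ofReal_ne_top)] at h1
    refine le_trans (measure_mono fun ω hω => ?_) h1
    have hω' : ν (Ici (recordState n (fun i => Y i ω) k).2) < ENNReal.ofReal (Real.exp (-s)) := hω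
    rw [mem_ofPred_eq, recordPotential, ENNReal.ofReal_mul (by positivity),
      ENNReal.ofReal_pow hl.le]
    refine mul_le_mul' (pow_le_pow_right_of_le_one' ?_ (recordState_fst_le hn _ k)) ?_
    · simpa using hl0.le
    · have := ENNReal.inv_le_inv.2 (ENNReal.rpow_le_rpow hω'.le hl0.le)
      rwa [← ENNReal.rpow_neg, ← ENNReal.rpow_neg, ENNReal.ofReal_rpow_of_pos (Real.exp_pos _),
        ← Real.exp_mul, neg_mul_neg, mul_comm s] at this
  · intro k k' hkk ω hω
    exact lt_of_le_of_lt (measure_mono (Ici_subset_Ici.2 (recordState_snd_mono n _ hkk))) hω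

/-- Almost surely every value is matched or exceeded later on. The comparison has to be
weak, because `ν` may have an atom at its essential supremum. -/
lemma ae_exists_ge [IsProbabilityMeasure P] [IsProbabilityMeasure ν]
    (hY : ∀ k, Measurable (Y k))
    (hind : iIndepFun Y P) (hlaw : ∀ k, P.map (Y k) = ν) :
    ∀ᵐ ω ∂P, ∀ k, ∃ i > k, Y k ω ≤ Y i ω := by
  -- It suffices to exceed countably many levels `a`, each with `ν [a, ∞) > 0`: the rational ones,
  -- or the largest one if it exists.
  obtain ⟨D, hDc, hDT, hD⟩ : ∃ D : Set ℝ, D.Countable ∧ (∀ a ∈ D, 0 < ν (Ici a)) ∧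
      ∀ x, 0 < ν (Ici x) → ∃ a ∈ D, x ≤ a := by
    by_cases hmax : ∃ m, IsGreatest {x | 0 < ν (Ici x)} m
    · obtain ⟨m, hm, hmu⟩ := hmax
      exact ⟨{m}, countable_singleton m, by simpa using hm, fun x hx => ⟨m, rfl, hmu hx⟩⟩
    · refine ⟨{x | 0 < ν (Ici x)} ∩ range ((↑) : ℚ → ℝ), (countable_range _).mono inter_subset_right,
        fun a ha => ha.1, fun x hx => ?_⟩
      obtain ⟨x', hx', hlt⟩ : ∃ x', 0 < ν (Ici x') ∧ x < x' := by
        by_contra! hcon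
        exact hmax ⟨x, hx, fun x' hx' => hcon x' hx'⟩
      obtain ⟨q, hq, hq'⟩ := exists_rat_btwn hlt
      exact ⟨q, ⟨hx'.trans_le (measure_mono (Ici_subset_Ici.2 hq'.le)), q, rfl⟩, hq.le⟩
  have h1 : ∀ a ∈ D, ∀ᵐ ω ∂P, ∃ᶠ i in atTop, a ≤ Y i ω := by
    intro a ha
    have hm (i : ℕ) : MeasurableSet (Y i ⁻¹' Ici a) := hY i measurableSet_Ici
    have hP (i : ℕ) : P (Y i ⁻¹' Ici a) = ν (Ici a) := by
      rw [← hlaw i, Measure.map_apply (hY i) measurableSet_Ici]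
    have hind' : iIndepSet (fun i => Y i ⁻¹' Ici a) P :=
      (iIndepSet_iff_meas_biInter hm).2 fun s =>
        hind.measure_inter_preimage_eq_mul s fun _ _ => measurableSet_Ici
    have hlim := measure_limsup_eq_one hm hind' (by
      simp only [hP]
      exact ENNReal.tsum_const_eq_top_of_ne_zero (hDT a ha).ne')
    have hae := (mem_ae_iff_prob_eq_one
      (MeasurableSet.measurableSet_limsup hm)).2 hlim
    filter_upwards [hae] with ω hω
    exact mem_limsup_iff_frequently_mem.1 hω
  have h2 : ∀ᵐ ω ∂P, ∀ k, 0 < ν (Ici (Y k ω)) := by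
    refine ae_all_iff.2 fun k => ?_
    have h0 : ν {x | ν (Ici x) ≤ 0} = 0 := le_antisymm (measure_tail_le_le ν 0) bot_le
    have h0' : ∀ᵐ x ∂P.map (Y k), 0 < ν (Ici x) := by
      rw [hlaw k]; simpa [ae_iff] using h0
    exact ae_of_ae_map (hY k).aemeasurable h0'
  filter_upwards [(ae_ball_iff hDc).2 h1, h2] with ω hω1 hω2 k
  obtain ⟨a, ha, hle⟩ := hD _ (hω2 k)
  obtain ⟨i, hi, hai⟩ := frequently_atTop.1 (hω1 a ha) (k + 1)
  exact ⟨i, hi, hle.trans hai⟩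

end iid

/-- The optimized exponent is `l = 1 - n / s`; with `a = √(2 log (1/δ) / n)` the inequality reduces to
`1 + a + a ^ 2 / 2 ≤ exp a`. -/
lemma exp_neg_div_one_sub_pow_le {n : ℕ} (hn : 1 ≤ n) {δ : ℝ} (hδ : δ ∈ Ioo (0 : ℝ) 1) :
    ∃ l : ℝ, 0 < l ∧ l < 1 ∧
      Real.exp (-(l * (n + √(2 * n * Real.log (1 / δ)) + Real.log (1 / δ)))) / (1 - l) ^ n ≤ δ := by
  set L := Real.log (1 / δ) with hL
  have hLpos : 0 < L := Real.log_pos ((one_lt_div hδ.1).2 hδ.2)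
  have hn0 : (0 : ℝ) < n := by exact_mod_cast hn
  set s := (n : ℝ) + √(2 * n * L) + L with hs
  have hsq : 0 ≤ √(2 * n * L) := Real.sqrt_nonneg _
  have hns : n < s := by linarith
  have hs0 : 0 < s := hn0.trans hns
  refine ⟨1 - n / s, by rw [sub_pos, div_lt_one hs0]; exact hns, by
    have : 0 < n / s := by positivity
    linarith, ?_⟩
  have h1 : (1 - n / s) * s = √(2 * n * L) + L := by
    rw [sub_mul, one_mul, div_mul_cancel₀ _ hs0.ne', hs]; ring
  have hexp : s / n ≤ Real.exp (√(2 * n * L) / n) := by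
    refine le_trans (le_of_eq ?_) (Real.quadratic_le_exp_of_nonneg (by positivity))
    rw [div_pow, Real.sq_sqrt (by positivity), hs]
    field_simp
  have hδL : Real.exp (-L) = δ := by
    rw [hL, one_div, Real.log_inv, neg_neg, Real.exp_log hδ.1]
  rw [h1, sub_sub_cancel, div_eq_mul_inv, ← inv_pow, inv_div]
  calc _ ≤ Real.exp (-(√(2 * n * L) + L)) * Real.exp (√(2 * n * L) / n) ^ n := by gcongr
    _ = δ := by
      rw [← Real.exp_nat_mul, ← Real.exp_add, mul_div_cancel₀ _ hn0.ne', neg_add_rev,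
        neg_add_cancel_right, hδL]


/-! ### Runs of RankOpt -/

section run

variable {𝒳 : Type*} {f : 𝒳 → ℝ} {ℛ : Set (𝒳 → 𝒳 → SignType)} {n : ℕ} {u : ℕ → 𝒳}

lemma le_iff_of_rankingRule_eq {h : 𝒳 → ℝ} (hfh : rankingRule f = rankingRule h) (a b : 𝒳) :
    h a ≤ h b ↔ f a ≤ f b := by
  have := congrFun (congrFun hfh b) a
  simp only [rankingRule] at this
  rw [← sub_nonneg, ← sign_nonneg_iff, ← this, sign_nonneg_iff, sub_nonneg]

lemma accepts_of_le (hf : rankingRule f ∈ ℛ) {x : ℕ → 𝒳} {t i : ℕ} {z : 𝒳} (h : f (x i) ≤ f z) :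
    Accepts f ℛ x t i z :=
  ⟨rankingRule f, ⟨hf, by simp [empiricalLoss]⟩, sign_nonneg_iff.2 (sub_nonneg.2 h)⟩

lemma accepts_congr {x x' : ℕ → 𝒳} {t i : ℕ} (hi : i ∈ Finset.Icc 1 t)
    (h : ∀ j ∈ Finset.Icc 1 t, x j = x' j) (z : 𝒳) : Accepts f ℛ x t i z ↔ Accepts f ℛ x' t i z := by
  have hloss (r : 𝒳 → 𝒳 → SignType) : empiricalLoss f x t r = empiricalLoss f x' t r := by
    unfold empiricalLoss
    congr 1
    refine Finset.sum_congr rfl fun b hb => Finset.sum_congr rfl fun a ha => ?_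
    simp only [Finset.mem_Icc, Finset.mem_Ico] at hb ha
    rw [h b (Finset.mem_Icc.2 hb), h a (Finset.mem_Icc.2 ⟨ha.1, ha.2.le.trans hb.2⟩)]
  simp only [Accepts, activeSubset, mem_ofPred_eq, hloss, h i hi]

/-- The state of the weak records at the time of the `t`-th evaluation: at most `t` records have
occurred, and the last one has the value of the best evaluation point. The values are recorded
through any `y` that orders the stream as `f` does. -/
lemma IsRun.recordState_time {time best : ℕ → ℕ} (hrun : IsRun f ℛ n u time best)
    (hf : rankingRule f ∈ ℛ) {y : ℕ → ℝ} (hy : ∀ i j, y i ≤ y j ↔ f (u i) ≤ f (u j))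
    {t : ℕ} (ht : 1 ≤ t) (htn : t ≤ n) :
    (recordState n y (time t)).1 ≤ t ∧ (recordState n y (time t)).2 = y (time (best t)) := by
  induction t, ht using Nat.le_induction with
  | base =>
    have hb : best 1 = 1 := by simpa using hrun.best_mem 1 le_rfl htn
    simp [hb, hrun.time_one, recordState]
  | succ t ht ih =>
    obtain ⟨ih1, ih2⟩ := ih (by omega)
    obtain ⟨⟨hlt, -⟩, hleast⟩ := hrun.time_succ t ht htn
    -- A discarded candidate is not a weak record, since weak records are accepted.
    have hconst (k : ℕ) (hk : time t + k < time (t + 1)) :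
        recordState n y (time t + k) = recordState n y (time t) := by
      induction k with
      | zero => rfl
      | succ k ihk =>
        rw [← add_assoc, recordState, ihk (by omega), recordStep, if_neg]
        rintro ⟨-, hle⟩
        rw [ih2, hy] at hle
        have := hleast ⟨by omega, accepts_of_le hf hle⟩
        omega
    obtain ⟨k, hk⟩ := Nat.exists_eq_add_of_lt hlt
    have hstate : recordState n y (time (t + 1)) =
        recordStep n (recordState n y (time t)) (y (time (t + 1))) := by
      rw [hk, recordState, hconst k (by omega)]
    have hbt := hrun.best_mem t ht (by omega)
    have hbt' := hrun.best_mem (t + 1) (by omega) htn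
    simp only [Finset.mem_Icc] at hbt hbt'
    have hmax (i : ℕ) (h1 : 1 ≤ i) (hi : i ≤ t) : y (time i) ≤ y (time (best t)) :=
      (hy _ _).2 (hrun.best_max t ht (by omega) i (Finset.mem_Icc.2 ⟨h1, hi⟩))
    have hmax' (i : ℕ) (h1 : 1 ≤ i) (hi : i ≤ t + 1) : y (time i) ≤ y (time (best (t + 1))) :=
      (hy _ _).2 (hrun.best_max (t + 1) (by omega) htn i (Finset.mem_Icc.2 ⟨h1, hi⟩))
    have hcases : y (time (best (t + 1))) ≤ max (y (time (best t))) (y (time (t + 1))) := by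
      rcases hbt'.2.eq_or_lt with h | h
      · rw [h]; exact le_max_right _ _
      · exact (hmax _ hbt'.1 (by omega)).trans (le_max_left _ _)
    rw [hstate, recordStep, ih2]
    split_ifs with h
    · refine ⟨by simpa using ih1, le_antisymm (hmax' _ (by omega) le_rfl) ?_⟩
      simpa [h.2] using hcases
    · have hlt' : y (time (t + 1)) < y (time (best t)) := by
        by_contra! hcon
        exact h ⟨by omega, hcon⟩
      refine ⟨by omega, ?_⟩
      rw [ih2]
      refine le_antisymm (hmax' _ hbt.1 (by omega)) ?_
      rwa [max_eq_left hlt'.le] at hcases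

/-- If every value is matched or exceeded later on, then no search for the next evaluation point goes
on forever. -/
lemma exists_isRun (hf : rankingRule f ∈ ℛ) (hu : ∀ k, ∃ i > k, f (u k) ≤ f (u i)) (hn : 1 ≤ n) :
    ∃ time best, IsRun f ℛ n u time best := by
  have hu' (k m : ℕ) : ∃ i > m, f (u k) ≤ f (u i) := by
    induction m with
    | zero =>
      obtain ⟨i, hi, h⟩ := hu k
      exact ⟨i, by omega, h⟩
    | succ m ih =>
      obtain ⟨i, hi, h⟩ := ih
      obtain ⟨j, hj, h'⟩ := hu i
      exact ⟨j, by omega, h.trans h'⟩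
  induction n, hn using Nat.le_induction with
  | base =>
    refine ⟨fun _ => 0, fun _ => 1, rfl, ?_, fun _ _ _ _ _ => le_rfl, fun t h1 h2 => by omega⟩
    intro t h1 _
    simpa using h1
  | succ n hn ih =>
    obtain ⟨time, best, hrun⟩ := ih
    have hne : {k | time n < k ∧ Accepts f ℛ (fun i => u (time i)) n (best n) (u k)}.Nonempty := by
      obtain ⟨i, hi, h⟩ := hu' (time (best n)) (time n)
      exact ⟨i, hi, accepts_of_le hf h⟩
    set T := sInf {k | time n < k ∧ Accepts f ℛ (fun i => u (time i)) n (best n) (u k)} with hT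
    have hTl := isLeast_csInf hne
    rw [← hT] at hTl
    let time' := Function.update time (n + 1) T
    have htime (t : ℕ) (ht : t ≤ n) : time' t = time t :=
      Function.update_of_ne (by omega) _ _
    obtain ⟨b, hb, hbmax⟩ := Finset.exists_max_image (Finset.Icc 1 (n + 1))
      (fun i => f (u (time' i))) ⟨1, by simp⟩
    let best' := Function.update best (n + 1) b
    have hbest (t : ℕ) (ht : t ≤ n) : best' t = best t :=
      Function.update_of_ne (by omega) _ _
    have hbest1 : best' (n + 1) = b := Function.update_self _ _ _
    have hacc (t : ℕ) (h1 : 1 ≤ t) (h2 : t ≤ n) (z : 𝒳) :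
        Accepts f ℛ (fun i => u (time' i)) t (best' t) z ↔
          Accepts f ℛ (fun i => u (time i)) t (best t) z := by
      rw [hbest t h2]
      refine accepts_congr (hrun.best_mem t h1 h2) (fun j hj => ?_) z
      rw [htime j ((Finset.mem_Icc.1 hj).2.trans h2)]
    refine ⟨time', best', ⟨(htime 1 hn).trans hrun.time_one, ?_, ?_, ?_⟩⟩
    · intro t h1 h2
      rcases h2.eq_or_lt with rfl | h2
      · rwa [hbest1]
      · rw [hbest t (by omega)]
        exact hrun.best_mem t h1 (by omega)
    · intro t h1 h2 i hi
      rcases h2.eq_or_lt with rfl | h2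
      · rw [hbest1]
        exact hbmax i hi
      · have hbm := Finset.mem_Icc.1 (hrun.best_mem t h1 (by omega))
        rw [hbest t (by omega), htime i ((Finset.mem_Icc.1 hi).2.trans (by omega)),
          htime (best t) (by omega)]
        exact hrun.best_max t h1 (by omega) i hi
    · intro t h1 h2
      simp only [hacc t h1 (by omega), htime t (by omega)]
      rcases (Nat.lt_succ_iff.1 h2).eq_or_lt with rfl | h2
      · rwa [show time' (t + 1) = T from Function.update_self _ _ _]
      · rw [htime (t + 1) (by omega)]
        exact hrun.time_succ t h1 h2

end run

/-! ### Superlevel sets and volumes -/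

section geometry

variable {d : ℕ} {X : Set (EuclideanSpace ℝ (Fin d))}

/-- Superlevel sets lie in balls about the maximizer. The hypothesis on `h` makes the level sets of
`f`, which need not be continuous, those of a continuous function. -/
lemma HasRegularLevelSets.norm_sub_le (hXcompact : IsCompact X) (hXconvex : Convex ℝ X)
    {f h : X → ℝ} {c α : ℝ} {xs : X} (hreg : HasRegularLevelSets f c α xs) (hh : Continuous h)
    (hfh : ∀ a b, h a ≤ h b ↔ f a ≤ f b) {x z : X} (hzx : f z ≤ f x) :
    ‖(xs : EuclideanSpace ℝ (Fin d)) - x‖ ≤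
      c * ‖(xs : EuclideanSpace ℝ (Fin d)) - z‖ ^ (1 / (1 + α)) := by
  have hα := hreg.α_nonneg
  have hβ : 0 ≤ 1 / (1 + α) := by positivity
  -- By the intermediate value theorem the level of `x` is met on the segment from `xs` to `z`.
  obtain ⟨w, hwf, hw⟩ : ∃ w : X, f w = f x ∧
      ‖(xs : EuclideanSpace ℝ (Fin d)) - w‖ ≤ ‖(xs : EuclideanSpace ℝ (Fin d)) - z‖ := by
    let γ : unitInterval → X := fun s =>
      ⟨AffineMap.lineMap (xs : EuclideanSpace ℝ (Fin d)) z (s : ℝ),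
        hXconvex.lineMap_mem xs.2 z.2 s.2⟩
    have hγ : Continuous γ := by
      refine Continuous.subtype_mk ?_ _
      exact AffineMap.lineMap_continuous.comp continuous_subtype_val
    have hγ0 : γ 0 = xs := Subtype.ext (by simp [γ])
    have hγ1 : γ 1 = z := Subtype.ext (by simp [γ])
    have hmem : h x ∈ range (h ∘ γ) := by
      refine mem_range_of_exists_le_of_exists_ge (hh.comp hγ) ⟨1, ?_⟩ ⟨0, ?_⟩
      · simpa [hγ1] using (hfh z x).2 hzx
      · simpa [hγ0] using (hfh x xs).2 (hreg.isMax x)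
    obtain ⟨s, hs⟩ := hmem
    refine ⟨γ s, le_antisymm ((hfh _ _).1 hs.le) ((hfh _ _).1 hs.ge), ?_⟩
    have : ‖(xs : EuclideanSpace ℝ (Fin d)) - γ s‖ =
        s * ‖(xs : EuclideanSpace ℝ (Fin d)) - z‖ := by
      rw [← dist_eq_norm, ← dist_eq_norm, dist_left_lineMap, Real.norm_of_nonneg s.2.1]
    rw [this]
    exact mul_le_of_le_one_left (norm_nonneg _) s.2.2
  obtain ⟨B, hB⟩ := hXcompact.isBounded.subset_closedBall (xs : EuclideanSpace ℝ (Fin d))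
  have hbdd : BddAbove ((fun v : X => ‖(xs : EuclideanSpace ℝ (Fin d)) - v‖) '' (f ⁻¹' {f x})) := by
    refine ⟨B, ?_⟩
    rintro _ ⟨v, -, rfl⟩
    exact mem_closedBall_iff_norm'.1 (hB v.2)
  calc _ ≤ sSup ((fun v : X => ‖(xs : EuclideanSpace ℝ (Fin d)) - v‖) '' (f ⁻¹' {f x})) :=
        le_csSup hbdd ⟨x, rfl, rfl⟩
    _ ≤ c * sInf ((fun v : X => ‖(xs : EuclideanSpace ℝ (Fin d)) - v‖ ^ (1 / (1 + α))) ''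
          (f ⁻¹' {f x})) := hreg.regular _ ⟨x, rfl⟩
    _ ≤ c * ‖(xs : EuclideanSpace ℝ (Fin d)) - w‖ ^ (1 / (1 + α)) := by
        refine mul_le_mul_of_nonneg_left (csInf_le ⟨0, ?_⟩ ⟨w, hwf, rfl⟩) hreg.c_pos.le
        rintro _ ⟨v, -, rfl⟩
        exact Real.rpow_nonneg (norm_nonneg _) _
    _ ≤ _ := mul_le_mul_of_nonneg_left (Real.rpow_le_rpow (norm_nonneg _) hw hβ) hreg.c_pos.le

lemma innerRadius_mul_le (hd : 1 ≤ d) (hX : IsCompact X) (hXint : (interior X).Nonempty)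
    {x : EuclideanSpace ℝ (Fin d)} {R s : ℝ} (hR : 0 ≤ R)
    (h : ENNReal.ofReal (Real.exp (-s)) ≤ volume (X ∩ Metric.closedBall x R) / volume X) :
    innerRadius X * Real.exp (-s / d) ≤ R := by
  have hd0 : (d : ℝ) ≠ 0 := by positivity
  have hXpos : 0 < volume X := Measure.measure_pos_of_nonempty_interior _ hXint
  have hne : {r : ℝ | 0 < r ∧ ∃ x ∈ X, Metric.closedBall x r ⊆ X}.Nonempty := by
    obtain ⟨x, hx⟩ := hXint
    obtain ⟨r, hr, hsub⟩ := Metric.nhds_basis_closedBall.mem_iff.1 (mem_interior_iff_mem_nhds.1 hx)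
    exact ⟨r, hr, x, interior_subset hx, hsub⟩
  rw [← le_div_iff₀ (Real.exp_pos _)]
  refine csSup_le hne ?_
  rintro r ⟨hr, x', -, hsub⟩
  rw [le_div_iff₀ (Real.exp_pos _)]
  have hvol : ENNReal.ofReal (Real.exp (-s)) * volume (Metric.closedBall x' r) ≤
      volume (Metric.closedBall x R) := by
    rw [ENNReal.le_div_iff_mul_le (Or.inl hXpos.ne') (Or.inl hX.measure_lt_top.ne)] at h
    calc _ ≤ ENNReal.ofReal (Real.exp (-s)) * volume X := by gcongr
      _ ≤ _ := h.trans (measure_mono inter_subset_right)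
  rw [Measure.addHaar_closedBall _ _ hr.le, Measure.addHaar_closedBall _ _ hR, ← mul_assoc,
    ENNReal.mul_le_mul_iff_left (Metric.measure_ball_pos _ _ one_pos).ne' measure_ball_lt_top.ne,
    ← ENNReal.ofReal_mul (Real.exp_pos _).le, ENNReal.ofReal_le_ofReal_iff (by positivity),
    finrank_euclideanSpace_fin] at hvol
  refine (pow_le_pow_iff_left₀ (by positivity) hR (show d ≠ 0 by omega)).1 ?_
  rwa [mul_pow, ← Real.exp_nat_mul, mul_div_cancel₀ _ hd0, mul_comm]

end geometry

/-- The first hypothesis alone bounds `D` below by `(ρ / c) ^ (1 + α)`. The second one, which is the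
regularity of the level set of `z` itself, trades this for the exponent `(1 + α) ^ 2`. -/
lemma rpow_lower_bound {c α ρ D : ℝ} (hc : 0 < c) (hα : 0 ≤ α) (hρ : 0 ≤ ρ) (hD : 0 ≤ D)
    (h1 : ρ ≤ c * D ^ (1 / (1 + α))) (h2 : D ≤ c * D ^ (1 / (1 + α))) :
    c ^ (-((1 + α) * (2 + α))) * ρ ^ ((1 + α) ^ 2) ≤ D := by
  have hα' : 0 < 1 + α := by linarith
  have h3 : ρ ^ ((1 + α) ^ 2) ≤ c ^ ((1 + α) * (2 + α)) * D := by
    calc ρ ^ ((1 + α) ^ 2) ≤ (c * (c * D ^ (1 / (1 + α))) ^ (1 / (1 + α))) ^ ((1 + α) ^ 2) := by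
          gcongr
          exact h1.trans (by gcongr)
      _ = c ^ ((1 + α) * (2 + α)) * D := by
          rw [Real.mul_rpow hc.le (by positivity), ← Real.rpow_mul (by positivity),
            Real.mul_rpow hc.le (by positivity), ← Real.rpow_mul hD, ← mul_assoc,
            ← Real.rpow_add hc,
            show (1 + α) ^ 2 + 1 / (1 + α) * (1 + α) ^ 2 = (1 + α) * (2 + α) by field_simp; ring,
            show 1 / (1 + α) * (1 / (1 + α) * (1 + α) ^ 2) = 1 by field_simp, Real.rpow_one]
  rw [Real.rpow_neg hc.le, inv_mul_le_iff₀ (by positivity)]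
  exact h3

end RankOpt

theorem mainTheorem2 {d : ℕ} (hd : 1 ≤ d)
    (X : Set (EuclideanSpace ℝ (Fin d))) (hXcompact : IsCompact X) (hXconvex : Convex ℝ X)
    (hXint : (interior X).Nonempty)
    (ℛ : Set (X → X → SignType)) (hℛ : ℛ ⊆ RankOpt.continuousRankingRules X)
    (f : X → ℝ) (hf : RankOpt.rankingRule f ∈ ℛ)
    (c α : ℝ) (xs : X) (hreg : RankOpt.HasRegularLevelSets f c α xs)
    {Ω : Type*} [MeasurableSpace Ω] (P : Measure Ω) [IsProbabilityMeasure P]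
    (U : ℕ → Ω → X) (hUmeas : ∀ k, Measurable (U k)) (hUindep : iIndepFun U P)
    (hUunif : ∀ k, pdf.IsUniform (fun ω => (U k ω : EuclideanSpace ℝ (Fin d))) X P volume)
    (n : ℕ) (hn : 1 ≤ n) (δ : ℝ) (hδ : δ ∈ Set.Ioo (0 : ℝ) 1) :
    ∃ A : Set Ω, MeasurableSet A ∧ 1 - δ ≤ P.real A ∧ ∀ ω ∈ A,
      (∃ z : X, RankOpt.IsOutput f ℛ n (fun k => U k ω) z) ∧
      ∀ z : X, RankOpt.IsOutput f ℛ n (fun k => U k ω) z →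
        c ^ (-((1 + α) * (2 + α))) * RankOpt.innerRadius X ^ ((1 + α) ^ 2) *
            Real.exp (-((1 + α) ^ 2 / (d : ℝ)) *
              ((n : ℝ) + √(2 * (n : ℝ) * Real.log (1 / δ)) + Real.log (1 / δ))) ≤
          ‖(xs : EuclideanSpace ℝ (Fin d)) - z‖ := by
  obtain ⟨h, hh, hfh'⟩ := hℛ hf
  have hfh := RankOpt.le_iff_of_rankingRule_eq hfh'
  have hα := hreg.α_nonneg
  have hXpos : volume X ≠ 0 := (Measure.measure_pos_of_nonempty_interior _ hXint).ne'
  have hXtop : volume X ≠ ⊤ := hXcompact.measure_lt_top.ne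
  set s := (n : ℝ) + √(2 * (n : ℝ) * Real.log (1 / δ)) + Real.log (1 / δ) with hs
  let Y : ℕ → Ω → ℝ := fun k ω => h (U k ω)
  have hY (k : ℕ) : Measurable (Y k) := hh.measurable.comp (hUmeas k)
  have hind : iIndepFun Y P := hUindep.comp (fun _ => h) fun _ => hh.measurable
  let ν : Measure ℝ := P.map (Y 0)
  have hν : IsProbabilityMeasure ν := Measure.isProbabilityMeasure_map (hY 0).aemeasurable
  have hemb : MeasurableEmbedding ((↑) : X → EuclideanSpace ℝ (Fin d)) :=
    MeasurableEmbedding.subtype_coe hXcompact.measurableSet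
  have hlaw (k : ℕ) : P.map (Y k) = ν := by
    have hU : P.map (U k) = P.map (U 0) := by
      have h1 (k : ℕ) : (P.map (U k)).map ((↑) : X → EuclideanSpace ℝ (Fin d)) =
          ProbabilityTheory.cond volume X := by
        rw [Measure.map_map measurable_subtype_coe (hUmeas k)]
        exact hUunif k
      rw [← hemb.comap_map (P.map (U k)), h1 k, ← h1 0, hemb.comap_map]
    change P.map (h ∘ U k) = P.map (h ∘ U 0)
    rw [← Measure.map_map hh.measurable (hUmeas k), hU, Measure.map_map hh.measurable (hUmeas 0)]
  obtain ⟨l, hl0, hl1, hl⟩ := RankOpt.exp_neg_div_one_sub_pow_le hn hδ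
  rw [← hs] at hl
  have htail := (RankOpt.measure_recordState_tail_lt_le hY hind hlaw hl0 hl1 hn s).trans
    (ENNReal.ofReal_le_ofReal hl)
  set B := {ω | ∃ k, ν (Set.Ici (RankOpt.recordState n (fun i => Y i ω) k).2) <
    ENNReal.ofReal (Real.exp (-s))} with hB
  set N := {ω | ∀ k, ∃ i > k, Y k ω ≤ Y i ω} with hN
  have hBmeas : MeasurableSet B := by
    rw [hB, Set.ofPred_exists]
    refine MeasurableSet.iUnion fun k => ?_
    exact measurableSet_lt ((RankOpt.measurable_measure_Ici ν).comp
      (measurable_snd.comp ((RankOpt.measurable_recordState n k).comp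
        (measurable_pi_lambda _ hY)))) measurable_const
  have hNmeas : MeasurableSet N := by
    have : N = ⋂ k, ⋃ i, ⋃ (_ : i > k), {ω | Y k ω ≤ Y i ω} := by ext; simp [hN]
    rw [this]
    exact MeasurableSet.iInter fun k => MeasurableSet.iUnion fun i => MeasurableSet.iUnion fun _ =>
      measurableSet_le (hY k) (hY i)
  have hN1 : P Nᶜ = 0 := RankOpt.ae_exists_ge hY hind hlaw
  refine ⟨Bᶜ ∩ N, hBmeas.compl.inter hNmeas, ?_, ?_⟩
  · have hcompl : P (Bᶜ ∩ N)ᶜ ≤ ENNReal.ofReal δ := by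
      rw [Set.compl_inter, compl_compl]
      exact (measure_union_le _ _).trans (by rw [hN1, add_zero]; exact htail)
    have := ENNReal.toReal_le_of_le_ofReal hδ.1.le hcompl
    have h2 := probReal_compl_eq_one_sub (μ := P) (hBmeas.compl.inter hNmeas)
    rw [Measure.real] at h2
    linarith
  rintro ω ⟨hωB, hωN⟩
  refine ⟨?_, ?_⟩
  · obtain ⟨time, best, hrun⟩ := RankOpt.exists_isRun (u := fun k => U k ω) hf
      (fun k => (hωN k).imp fun i hi => ⟨hi.1, (hfh _ _).1 hi.2⟩) hn
    exact ⟨_, time, best, hrun, rfl⟩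
  rintro z ⟨time, best, hrun, hz⟩
  have hstate := (hrun.recordState_time hf (y := fun i => Y i ω) (fun i j => hfh _ _) hn le_rfl).2
  -- The `n`-th evaluation is done, and the last counted record has the value of the output.
  have hmass : ENNReal.ofReal (Real.exp (-s)) ≤ ν (Set.Ici (h z)) := by
    by_contra! hcon
    refine hωB ⟨time n, ?_⟩
    rw [hstate, hz] at *
    exact hcon
  set D := ‖(xs : EuclideanSpace ℝ (Fin d)) - z‖ with hD
  have hc := hreg.c_pos
  have hnorm (x : X) (hx : f z ≤ f x) := hreg.norm_sub_le hXcompact hXconvex hh hfh hx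
  have hvol : ENNReal.ofReal (Real.exp (-s)) ≤ volume (X ∩ Metric.closedBall
      (xs : EuclideanSpace ℝ (Fin d)) (c * D ^ (1 / (1 + α)))) / volume X := by
    rw [← (hUunif 0).measure_preimage hXpos hXtop Metric.isClosed_closedBall.measurableSet]
    refine hmass.trans ?_
    rw [Measure.map_apply (hY 0) measurableSet_Ici]
    refine measure_mono fun ω' hω' => ?_
    rw [Set.mem_preimage, mem_closedBall_iff_norm']
    exact hnorm _ ((hfh _ _).1 hω')
  have hrad := RankOpt.innerRadius_mul_le hd hXcompact hXint (by positivity) hvol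
  have hrad0 : 0 ≤ RankOpt.innerRadius X := Real.sSup_nonneg fun r hr => hr.1.le
  have hfin := RankOpt.rpow_lower_bound hc hα (by positivity) (norm_nonneg _) hrad (hnorm z le_rfl)
  rw [Real.mul_rpow hrad0 (Real.exp_pos _).le, ← Real.exp_mul, ← mul_assoc] at hfin
  convert hfin using 3
  ring
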